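/- **Proposition (Cohen–Macaulay in the sense of ideals implies Cohen–Macaulay).** Let $R$ be a commutative ring with identity (not necessarily Noetherian) and let $M$ be a finitely generated $R$-module. Suppose that $\operatorname{ht}_M(I)=\operatorname{p.grade}_R(I,M)$ for all ideals $I$ of $R$, or that this equality holds for all finitely generated ideals $I$ of $R$. Then $M$ is Cohen–Macaulay in the following sense: every strong parameter sequence on $M$ is an $M$-regular sequence. The notions are as follows. * A finite sequence $x_1,\dots,x_\ell$ in $R$ is *weak $M$-regular* if each $x_i$ is a non-zero-divisor on $M/(x_1,\dots,x_{i-1})M$; it is *$M$-regular* if moreover $M\neq(x_1,\dots,x_\ell)M$. The empty sequence is regarded as regular on every module. The classical grade $\operatorname{grade}(I,M)\in\mathbb N\cup\{\infty\}$ is the supremum of the lengths of the weak $M$-regular sequences contained in $I$, and $$\operatorname{p.grade}_R(I,M)=\lim_{m\to\infty}\operatorname{grade}\bigl(IR[t_1,\dots,t_m],\,R[t_1,\dots,t_m]\otimes_RM\bigr).$$ * For a prime $\mathfrak p$, $\operatorname{ht}_M\mathfrak p$ is the Krull dimension of the $R_{\mathfrak p}$-module $M_{\mathfrak p}$ (the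 Krull dimension of its support), and for an ideal $I$, $\operatorname{ht}_M(I)=\inf\{\operatorname{ht}_M\mathfrak p : \mathfrak p\in\operatorname{Supp}M,\ I\subseteq\mathfrak p\}$, with $\inf\emptyset=\infty$. * Let $\mathbf x=x_1,\dots,x_\ell$ be a finite sequence in $R$, and let $\mathbf x^n=x_1^n,\dots,x_\ell^n$. Let $H_i(\mathbf x,M)$ denote the Koszul homology and $H^i_{\mathbf x}(M)$ the cohomology of the Čech complex $\bigotimes_{j}(0\to R\to R_{x_j}\to0)\otimes_RM$. The sequence $\mathbf x$ is *$M$-weakly proregular* if for each $n$ there is $m\ge n$ such that the map $H_i(\mathbf x^m,M)\to H_i(\mathbf x^n,M)$ is zero for all $i\ge1$; here the map is induced by the tensor product of the chain maps from $0\to M\xrightarrow{x_j^m}M\to0$ to $0\to M\xrightarrow{x_j^n}M\to0$ that are $x_j^{m-n}$ in degree $1$ and the identity in degree $0$. * $\mathbf x$ is a *parameter sequence on $M$* if $\mathbf x$ is $M$-weakly proregular, $\mathbf xM\neq M$, and $H^{\ell}_{\mathbf x}(M)_{\mathfrak p}\neq0$ for all primes $\mathfrak p\in\operatorname{Supp}_R(M/\mathbf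 xM)$. The empty sequence is regarded as a parameter sequence on every module. $\mathbf x$ is a *strong parameter sequence on $M$* if $x_1,\dots,x_i$ is a parameter sequence on $M$ for $i=1,\dots,\ell$. -/

import Mathlib

open scoped TensorProduct

noncomputable section

namespace NonNoethCM

universe u v

/-! ### Signs -/

/-- `(-1)` to the number of elements of `T` that are smaller than `j`. -/
def sgn (R : Type u) [CommRing R] {n : ℕ} (j : Fin n) (T : Finset (Fin n)) : R :=
  (-1) ^ (T.filter (fun i => i < j)).card

lemma sgn_swap_aux (R : Type u) [CommRing R] {n : ℕ} {j k : Fin n} {T : Finset (Fin n)} (hj : j ∉ T) (h : j < k) :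
    sgn R j T * sgn R k (insert j T) + sgn R k T * sgn R j (insert k T) = 0 := by
  have h1 : (insert j T).filter (fun i => i < k) = insert j (T.filter (fun i => i < k)) := by
    rw [Finset.filter_insert, if_pos h]
  have h2 : (insert k T).filter (fun i => i < j) = T.filter (fun i => i < j) := by
    rw [Finset.filter_insert, if_neg (not_lt.mpr h.le)]
  have h3 : j ∉ T.filter (fun i => i < k) := fun h' => hj (Finset.mem_filter.mp h').1
  unfold sgn
  rw [h1, h2, Finset.card_insert_of_notMem h3]
  ring

lemma sgn_swap (R : Type u) [CommRing R] {n : ℕ} {j k : Fin n} {T : Finset (Fin n)} (hj : j ∉ T) (hk : k ∉ T)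
    (h : j ≠ k) : sgn R j T * sgn R k (insert j T) + sgn R k T * sgn R j (insert k T) = 0 := by
  rcases lt_or_gt_of_ne h with h | h
  · exact sgn_swap_aux R hj h
  · rw [add_comm]; exact sgn_swap_aux R hk h

lemma sum_sum_eq_zero {n : ℕ} {A : Type*} [AddCommGroup A] (a : Fin n → Fin n → A)
    (h0 : ∀ j, a j j = 0) (h : ∀ j k, j ≠ k → a j k + a k j = 0) : ∑ j, ∑ k, a j k = 0 := by
  rw [← Fintype.sum_prod_type' (f := a)]
  refine Finset.sum_involution (fun p _ => p.swap) ?_ ?_ (fun _ _ => Finset.mem_univ _)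
    (fun _ _ => Prod.swap_swap _)
  · rintro ⟨j, k⟩ -
    by_cases hjk : j = k
    · subst hjk; simp [h0]
    · exact h j k hjk
  · rintro ⟨j, k⟩ - hne heq
    have : k = j := congrArg Prod.fst heq
    subst this
    exact hne (h0 _)

/-! ### The Koszul complex -/

section Koszul

variable {R : Type u} [CommRing R] {n : ℕ} (x : Fin n → R) (M : Type v) [AddCommGroup M]
  [Module R M]

/-- The subsets of `{0, …, n-1}` with `p` elements. -/
abbrev IdxSet (n p : ℕ) : Type := {S : Finset (Fin n) // S.card = p}

/-- The differential `K_{p+1}(x, M) → K_p(x, M)` of the Koszul complex. Here `K_p(x, M)` is the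
direct sum of copies of `M` indexed by the `p`-element subsets `S` of `{0, …, n-1}`, the copy of
index `S = {s₁ < ⋯ < s_p}` being `e_{s₁} ∧ ⋯ ∧ e_{s_p} ⊗ M`. -/
def koszulD (p : ℕ) : (IdxSet n (p + 1) → M) →ₗ[R] (IdxSet n p → M) where
  toFun f T := ∑ j : Fin n,
    if h : j ∉ T.1 then
      sgn R j T.1 • x j • f ⟨insert j T.1, by rw [Finset.card_insert_of_notMem h, T.2]⟩
    else 0
  map_add' f g := by
    funext T
    simp only [Pi.add_apply, ← Finset.sum_add_distrib]
    refine Finset.sum_congr rfl fun j _ => ?_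
    split_ifs <;> simp
  map_smul' r f := by
    funext T
    simp only [Pi.smul_apply, Finset.smul_sum, RingHom.id_apply]
    refine Finset.sum_congr rfl fun j _ => ?_
    split_ifs
    · rw [smul_zero]
    · rw [smul_comm r (sgn R j T.1), smul_comm r (x j)]

lemma koszulD_comp (p : ℕ) : koszulD x M p ∘ₗ koszulD x M (p + 1) = 0 := by
  refine LinearMap.ext fun f => funext fun T => ?_
  have key : (koszulD x M p ∘ₗ koszulD x M (p + 1)) f T = ∑ j : Fin n, ∑ k : Fin n,
      if h : j ∉ T.1 ∧ k ∉ insert j T.1 then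
        (sgn R j T.1 * sgn R k (insert j T.1)) • (x j * x k) •
          f ⟨insert k (insert j T.1), by
            rw [Finset.card_insert_of_notMem h.2, Finset.card_insert_of_notMem h.1, T.2]⟩
      else 0 := by
    rw [LinearMap.comp_apply]
    simp only [koszulD, LinearMap.coe_mk, AddHom.coe_mk]
    refine Finset.sum_congr rfl fun j _ => ?_
    by_cases hj : j ∉ T.1
    · rw [dif_pos hj, Finset.smul_sum, Finset.smul_sum]
      refine Finset.sum_congr rfl fun k _ => ?_
      by_cases hk : k ∉ insert j T.1
      · rw [dif_pos hk, dif_pos ⟨hj, hk⟩, smul_comm (x j) (sgn R k _), mul_smul, mul_smul]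
      · rw [dif_neg hk, dif_neg (fun h => hk h.2), smul_zero, smul_zero]
    · rw [dif_neg hj]
      symm
      exact Finset.sum_eq_zero fun k _ => dif_neg (fun h => hj h.1)
  rw [key]
  refine sum_sum_eq_zero _ (fun j => dif_neg (by simp)) (fun j k hjk => ?_)
  by_cases h : j ∉ T.1 ∧ k ∉ insert j T.1
  · obtain ⟨hj, hk⟩ := h
    have hk' : k ∉ T.1 := fun h => hk (Finset.mem_insert_of_mem h)
    have hj' : j ∉ insert k T.1 := by simp [hjk, hj]
    rw [dif_pos ⟨hj, hk⟩, dif_pos ⟨hk', hj'⟩]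
    have e : f ⟨insert j (insert k T.1), by
        rw [Finset.card_insert_of_notMem hj', Finset.card_insert_of_notMem hk', T.2]⟩ =
        f ⟨insert k (insert j T.1), by
        rw [Finset.card_insert_of_notMem hk, Finset.card_insert_of_notMem hj, T.2]⟩ := by
      congr 2; exact Finset.insert_comm _ _ _
    rw [e, mul_comm (x k), ← add_smul, sgn_swap R hj hk' hjk, zero_smul]
  · have h' : ¬ (k ∉ T.1 ∧ j ∉ insert k T.1) := by
      simp only [Finset.mem_insert, not_or] at h ⊢
      tauto
    rw [dif_neg h, dif_neg h', add_zero]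

/-- The Koszul complex `K_•(x, M)` of a finite sequence `x` with coefficients in `M`. -/
def koszulComplex : ChainComplex (ModuleCat.{v} R) ℕ :=
  ChainComplex.of (fun p => ModuleCat.of R (IdxSet n p → M))
    (fun p => ModuleCat.ofHom (koszulD x M p))
    (fun p => by
      rw [← ModuleCat.ofHom_comp, koszulD_comp]; rfl)

lemma koszulComplex_d (p : ℕ) :
    (koszulComplex x M).d (p + 1) p = ModuleCat.ofHom (koszulD x M p) := by
  dsimp only [koszulComplex]
  rw [ChainComplex.of_d]

/-- The degree `p` part of the map `K_•(x^m, M) → K_•(x^k, M)`, for `k ≤ m`: on the copy of `M`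
of index `S` it is the multiplication by `∏_{j ∈ S} x_j^(m-k)`. -/
def koszulPowMapX (m k p : ℕ) : (IdxSet n p → M) →ₗ[R] (IdxSet n p → M) where
  toFun f S := (∏ j ∈ S.1, x j ^ (m - k)) • f S
  map_add' f g := by funext S; simp
  map_smul' r f := by funext S; simp [smul_comm r]

lemma koszulPowMapX_comm {m k : ℕ} (h : k ≤ m) (p : ℕ) :
    koszulD (fun j => x j ^ k) M p ∘ₗ koszulPowMapX x M m k (p + 1) =
      koszulPowMapX x M m k p ∘ₗ koszulD (fun j => x j ^ m) M p := by
  refine LinearMap.ext fun f => funext fun T => ?_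
  simp only [LinearMap.comp_apply, koszulD, koszulPowMapX, LinearMap.coe_mk, AddHom.coe_mk,
    Finset.smul_sum]
  refine Finset.sum_congr rfl fun j _ => ?_
  by_cases hj : j ∉ T.1
  · rw [dif_pos hj, dif_pos hj, smul_comm _ (sgn R j T.1)]
    congr 1
    rw [← mul_smul, ← mul_smul, Finset.prod_insert hj, ← mul_assoc, ← pow_add,
      Nat.add_sub_cancel' h, mul_comm]
  · rw [dif_neg hj, dif_neg hj, smul_zero]

/-- The chain map `φ^m_k(x, M) : K_•(x^m, M) → K_•(x^k, M)` for `k ≤ m`, that is the tensor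
product of the maps `(x_j^(m-k), id)` from `M → M` (multiplication by `x_j^m`) to `M → M`
(multiplication by `x_j^k`). -/
def koszulPowMap {m k : ℕ} (h : k ≤ m) :
    koszulComplex (fun j => x j ^ m) M ⟶ koszulComplex (fun j => x j ^ k) M :=
  ChainComplex.ofHom (fun p => ModuleCat.ofHom (koszulPowMapX x M m k p))
    (fun p => by
      dsimp only [koszulComplex]
      rw [ChainComplex.of_d, ChainComplex.of_d, ← ModuleCat.ofHom_comp, ← ModuleCat.ofHom_comp, koszulPowMapX_comm x M h])

/-- The sequence `x` is `M`-weakly proregular: for each `k` there is `m ≥ k` such that the map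
`H_i(x^m, M) → H_i(x^k, M)` is zero for all `i ≥ 1`. -/
def IsWeaklyProregular : Prop :=
  ∀ k : ℕ, ∃ (m : ℕ) (h : k ≤ m), ∀ i : ℕ, 1 ≤ i →
    HomologicalComplex.homologyMap (koszulPowMap x M h) i = 0

end Koszul

/-! ### The Čech complex -/

section Cech

variable {R : Type u} [CommRing R] (M : Type v) [AddCommGroup M] [Module R M]

/-- The localization `M_a` of `M` at the powers of `a`. -/
abbrev Away (a : R) : Type (max u v) := LocalizedModule (Submonoid.powers a) M

lemma isUnit_of_dvd {a b : R} (h : a ∣ b) (s : Submonoid.powers a) :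
    IsUnit (algebraMap R (Module.End R (Away M b)) (s : R)) := by
  obtain ⟨c, rfl⟩ := h
  obtain ⟨_, k, rfl⟩ := s
  have hu : IsUnit (algebraMap R (Module.End R (Away M (a * c))) (a * c)) :=
    IsLocalizedModule.map_units (LocalizedModule.mkLinearMap (Submonoid.powers (a * c)) M)
      ⟨a * c, Submonoid.mem_powers _⟩
  rw [map_mul] at hu
  have ha : IsUnit (algebraMap R (Module.End R (Away M (a * c))) a) :=
    ((Algebra.commute_algebraMap_left _ _).isUnit_mul_iff.mp hu).1
  simpa using ha.pow k

/-- The natural map `M_a → M_b` for `a ∣ b`. -/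
def awayMap {a b : R} (h : a ∣ b) : Away M a →ₗ[R] Away M b :=
  IsLocalizedModule.lift (Submonoid.powers a) (LocalizedModule.mkLinearMap (Submonoid.powers a) M)
    (LocalizedModule.mkLinearMap (Submonoid.powers b) M) (isUnit_of_dvd M h)

lemma awayMap_mk {a b : R} (h : a ∣ b) (m : M) :
    awayMap M h (LocalizedModule.mkLinearMap (Submonoid.powers a) M m) =
      LocalizedModule.mkLinearMap (Submonoid.powers b) M m :=
  IsLocalizedModule.lift_apply _ _ _ _ _

lemma awayMap_comp {a b c : R} (h : a ∣ b) (h' : b ∣ c) :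
    awayMap M h' ∘ₗ awayMap M h = awayMap M (h.trans h') := by
  refine IsLocalizedModule.ext (Submonoid.powers a)
    (LocalizedModule.mkLinearMap (Submonoid.powers a) M) (isUnit_of_dvd M (h.trans h')) ?_
  refine LinearMap.ext fun m => ?_
  simp only [LinearMap.comp_apply, awayMap_mk]

variable {n : ℕ} (x : Fin n → R)

/-- The module `C^p(x; M)` of the Čech complex: the direct sum of the localizations
`M_{x_{s₁} ⋯ x_{s_p}}` over the `p`-element subsets `{s₁ < ⋯ < s_p}` of `{0, …, n-1}`. -/
abbrev CechX (p : ℕ) : Type (max u v) := (S : IdxSet n p) → Away M (∏ j ∈ S.1, x j)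

lemma prod_erase_dvd (T : Finset (Fin n)) (j : Fin n) : ∏ i ∈ T.erase j, x i ∣ ∏ i ∈ T, x i :=
  Finset.prod_dvd_prod_of_subset _ _ _ (Finset.erase_subset _ _)

/-- The differential `C^p(x; M) → C^{p+1}(x; M)` of the Čech complex: its component at `T` is the
alternating sum, over `j ∈ T`, of the localization maps from the component at `T \ {j}`. -/
def cechD (p : ℕ) : CechX M x p →ₗ[R] CechX M x (p + 1) where
  toFun f T := ∑ j : Fin n,
    if h : j ∈ T.1 then
      sgn R j (T.1.erase j) • awayMap M (prod_erase_dvd x T.1 j)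
        (f ⟨T.1.erase j, by rw [Finset.card_erase_of_mem h, T.2, Nat.add_sub_cancel]⟩)
    else 0
  map_add' f g := by
    funext T
    simp only [Pi.add_apply, ← Finset.sum_add_distrib]
    refine Finset.sum_congr rfl fun j _ => ?_
    split_ifs <;> simp
  map_smul' r f := by
    funext T
    simp only [Pi.smul_apply, Finset.smul_sum, RingHom.id_apply]
    refine Finset.sum_congr rfl fun j _ => ?_
    split_ifs
    · rw [map_smul, smul_comm r (sgn R j _)]
    · rw [smul_zero]

lemma awayMap_congr {p : ℕ} (f : CechX M x p) {b : R} {S S' : IdxSet n p} (e : S = S')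
    (h : ∏ j ∈ S.1, x j ∣ b) (h' : ∏ j ∈ S'.1, x j ∣ b) :
    awayMap M h (f S) = awayMap M h' (f S') := by
  subst e; rfl

lemma cechD_comp (p : ℕ) : cechD M x (p + 1) ∘ₗ cechD M x p = 0 := by
  refine LinearMap.ext fun f => funext fun T => ?_
  have key : (cechD M x (p + 1) ∘ₗ cechD M x p) f T = ∑ j : Fin n, ∑ k : Fin n,
      if h : j ∈ T.1 ∧ k ∈ T.1.erase j then
        (sgn R j (T.1.erase j) * sgn R k ((T.1.erase j).erase k)) •
          awayMap M ((prod_erase_dvd x (T.1.erase j) k).trans (prod_erase_dvd x T.1 j))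
          (f ⟨(T.1.erase j).erase k, by
            rw [Finset.card_erase_of_mem h.2, Finset.card_erase_of_mem h.1, T.2]; omega⟩)
      else 0 := by
    rw [LinearMap.comp_apply]
    simp only [cechD, LinearMap.coe_mk, AddHom.coe_mk]
    refine Finset.sum_congr rfl fun j _ => ?_
    by_cases hj : j ∈ T.1
    · rw [dif_pos hj, map_sum, Finset.smul_sum]
      refine Finset.sum_congr rfl fun k _ => ?_
      by_cases hk : k ∈ T.1.erase j
      · rw [dif_pos hk, dif_pos ⟨hj, hk⟩, map_smul, mul_smul, ← LinearMap.comp_apply,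
          awayMap_comp]
      · rw [dif_neg hk, dif_neg (fun h => hk h.2), map_zero, smul_zero]
    · rw [dif_neg hj]
      symm
      exact Finset.sum_eq_zero fun k _ => dif_neg (fun h => hj h.1)
  rw [key]
  refine sum_sum_eq_zero _ (fun j => dif_neg (by simp)) (fun j k hjk => ?_)
  by_cases h : j ∈ T.1 ∧ k ∈ T.1.erase j
  · obtain ⟨hj, hk⟩ := h
    have hk' : k ∈ T.1 := Finset.mem_of_mem_erase hk
    have hj' : j ∈ T.1.erase k := Finset.mem_erase.mpr ⟨hjk, hj⟩
    have hU : (T.1.erase k).erase j = (T.1.erase j).erase k := Finset.erase_right_comm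
    rw [dif_pos ⟨hj, hk⟩, dif_pos ⟨hk', hj'⟩,
      awayMap_congr M x f (Subtype.ext hU :
          (⟨(T.1.erase k).erase j, by
            rw [Finset.card_erase_of_mem hj', Finset.card_erase_of_mem hk', T.2]; omega⟩ :
            IdxSet n p) =
          ⟨(T.1.erase j).erase k, by
            rw [Finset.card_erase_of_mem hk, Finset.card_erase_of_mem hj, T.2]; omega⟩) _
        ((prod_erase_dvd x (T.1.erase j) k).trans (prod_erase_dvd x T.1 j)), ← add_smul, hU]
    have e1 : T.1.erase j = insert k ((T.1.erase j).erase k) := (Finset.insert_erase hk).symm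
    have e2 : T.1.erase k = insert j ((T.1.erase j).erase k) := by
      rw [← hU]; exact (Finset.insert_erase hj').symm
    have hs := sgn_swap R (j := j) (k := k) (T := (T.1.erase j).erase k) (by simp) (by simp) hjk
    rw [← e1, ← e2] at hs
    rw [show sgn R j (T.1.erase j) * sgn R k ((T.1.erase j).erase k) +
      sgn R k (T.1.erase k) * sgn R j ((T.1.erase j).erase k) = 0 by rw [← hs]; ring, zero_smul]
  · have h' : ¬ (k ∈ T.1 ∧ j ∈ T.1.erase k) := by
      simp only [Finset.mem_erase, ne_eq] at h ⊢
      tauto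
    rw [dif_neg h, dif_neg h', add_zero]

/-- The Čech complex `C(x; M)` of a finite sequence `x` with coefficients in `M`. -/
def cechComplex : CochainComplex (ModuleCat.{max u v} R) ℕ :=
  CochainComplex.of (fun p => ModuleCat.of R (CechX M x p))
    (fun p => ModuleCat.ofHom (cechD M x p))
    (fun p => by
      rw [← ModuleCat.ofHom_comp, cechD_comp]; rfl)

lemma cechComplex_d (p : ℕ) :
    (cechComplex M x).d p (p + 1) = ModuleCat.ofHom (cechD M x p) := by
  dsimp only [cechComplex]
  rw [CochainComplex.of_d]

/-- The `i`-th Čech cohomology `H^i_x(M)`. -/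
def cechCohomology (i : ℕ) : ModuleCat.{max u v} R := (cechComplex M x).homology i

end Cech

/-! ### Classical grade, polynomial grade and heights -/

section Grade

/-- The classical grade of `I` on `M`: the supremum of the lengths of the weak `M`-regular
sequences contained in `I`. -/
def grade {R : Type u} [CommRing R] (I : Ideal R) (M : Type v) [AddCommGroup M] [Module R M] :
    ℕ∞ :=
  ⨆ (rs : List R) (_ : (∀ r ∈ rs, r ∈ I) ∧ RingTheory.Sequence.IsWeaklyRegular M rs),
    (rs.length : ℕ∞)

variable {R : Type u} [CommRing R] (I : Ideal R) (M : Type v) [AddCommGroup M] [Module R M]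

/-- The classical grade of `I R[t₁, …, t_m]` on `R[t₁, …, t_m] ⊗ M`. -/
def gradeAdjoin (m : ℕ) : ℕ∞ :=
  grade (I.map (algebraMap R (MvPolynomial (Fin m) R))) (MvPolynomial (Fin m) R ⊗[R] M)

/-- The polynomial grade of `I` on `M`: the limit of the classical grades of `I R[t₁, …, t_m]` on
`R[t₁, …, t_m] ⊗ M` as `m → ∞`. The limit exists, see `tendsto_polynomialGrade`. -/
def polynomialGrade : ℕ∞ :=
  Filter.limUnder Filter.atTop (gradeAdjoin I M)

lemma grade_le_of_flat (A B : Type u) [CommRing A] [CommRing B] [Algebra R A] [Algebra R B]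
    [Algebra A B] [IsScalarTower R A B] [Module.Flat A B] :
    grade (I.map (algebraMap R A)) (A ⊗[R] M) ≤ grade (I.map (algebraMap R B)) (B ⊗[R] M) := by
  refine iSup₂_le fun rs h => ?_
  have h2 := h.2.of_flat_of_isBaseChange (TensorProduct.isBaseChange A (A ⊗[R] M) B)
  rw [LinearEquiv.isWeaklyRegular_congr
    (TensorProduct.AlgebraTensorModule.cancelBaseChange R A B B M)] at h2
  refine le_trans ?_ (le_iSup₂ (rs.map (algebraMap A B)) ⟨?_, h2⟩)
  · simp
  · intro r hr
    obtain ⟨s, hs, rfl⟩ := List.mem_map.mp hr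
    rw [IsScalarTower.algebraMap_eq R A B, ← Ideal.map_map]
    exact Ideal.mem_map_of_mem _ (h.1 s hs)

lemma gradeAdjoin_le_succ (m : ℕ) : gradeAdjoin I M m ≤ gradeAdjoin I M (m + 1) := by
  let _ : Algebra (MvPolynomial (Fin m) R) (MvPolynomial (Fin (m + 1)) R) :=
    ((MvPolynomial.finSuccEquiv R m).symm.toRingEquiv.toRingHom.comp Polynomial.C).toAlgebra
  have _ : IsScalarTower R (MvPolynomial (Fin m) R) (MvPolynomial (Fin (m + 1)) R) :=
    IsScalarTower.of_algebraMap_eq' (MvPolynomial.finSuccEquiv_comp_C_eq_C m).symm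
  have _ : Module.Flat (MvPolynomial (Fin m) R) (MvPolynomial (Fin (m + 1)) R) := by
    refine Module.Flat.of_linearEquiv (M := Polynomial (MvPolynomial (Fin m) R))
      { (MvPolynomial.finSuccEquiv R m).toRingEquiv with
        map_smul' := fun a b => ?_ }
    change MvPolynomial.finSuccEquiv R m
      ((MvPolynomial.finSuccEquiv R m).symm (Polynomial.C a) * b) = a • _
    rw [map_mul, AlgEquiv.apply_symm_apply, Polynomial.smul_eq_C_mul]
    rfl
  exact grade_le_of_flat I M (MvPolynomial (Fin m) R) (MvPolynomial (Fin (m + 1)) R)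

lemma tendsto_gradeAdjoin :
    Filter.Tendsto (gradeAdjoin I M) Filter.atTop (nhds (⨆ m, gradeAdjoin I M m)) :=
  tendsto_atTop_iSup (monotone_nat_of_le_succ (gradeAdjoin_le_succ I M))

lemma polynomialGrade_eq_iSup : polynomialGrade I M = ⨆ m, gradeAdjoin I M m :=
  (tendsto_gradeAdjoin I M).limUnder_eq

lemma tendsto_polynomialGrade :
    Filter.Tendsto (gradeAdjoin I M) Filter.atTop (nhds (polynomialGrade I M)) := by
  rw [polynomialGrade_eq_iSup]
  exact tendsto_gradeAdjoin I M

/-- The height `ht_M p` of a prime ideal: the Krull dimension of the `R_p`-module `M_p` (it is `⊥`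
if `M_p = 0`). -/
def primeHeight (p : PrimeSpectrum R) : WithBot ℕ∞ :=
  Module.supportDim (Localization.AtPrime p.asIdeal) (LocalizedModule p.asIdeal.primeCompl M)

/-- The height `ht_M I`: the infimum of `ht_M p` over the primes `p ∈ Supp M ∩ V(I)` (it is `⊤` if
there is no such prime). -/
def idealHeight : WithBot ℕ∞ :=
  ⨅ p ∈ Module.support R M ∩ PrimeSpectrum.zeroLocus (I : Set R), primeHeight M p

end Grade

/-! ### Parameter sequences and Cohen-Macaulay modules -/

section CM

variable (R : Type u) [CommRing R] (M : Type v) [AddCommGroup M] [Module R M]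

/-- `M`-regular sequences; the empty sequence is regular on every module, also on the zero
module. -/
def IsRegularSeq (xs : List R) : Prop :=
  xs = [] ∨ RingTheory.Sequence.IsRegular M xs

/-- Parameter sequences on `M`; the empty sequence is one on every module. -/
def IsParameterSeq (xs : List R) : Prop :=
  xs = [] ∨
    (IsWeaklyProregular xs.get M ∧
      (Ideal.ofList xs • ⊤ : Submodule R M) ≠ ⊤ ∧
      ∀ p ∈ Module.support R (M ⧸ (Ideal.ofList xs • ⊤ : Submodule R M)),
        Nontrivial (LocalizedModule p.asIdeal.primeCompl (cechCohomology M xs.get xs.length)))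

/-- Strong parameter sequences on `M`: `x₁, …, x_i` is a parameter sequence on `M` for all
`i = 1, …, ℓ`. -/
def IsStrongParameterSeq (xs : List R) : Prop :=
  ∀ i : ℕ, 1 ≤ i → i ≤ xs.length → IsParameterSeq R M (xs.take i)

/-- `M` is Cohen-Macaulay if every strong parameter sequence on `M` is an `M`-regular sequence. -/
def IsCohenMacaulay : Prop :=
  ∀ xs : List R, IsStrongParameterSeq R M xs → IsRegularSeq R M xs

/-- `M` is Cohen-Macaulay in the sense of ideals. -/
def IsCohenMacaulayIdeals : Prop :=
  ∀ I : Ideal R, idealHeight I M = (polynomialGrade I M : WithBot ℕ∞)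

/-- `M` is Cohen-Macaulay in the sense of finitely generated ideals. -/
def IsCohenMacaulayFGIdeals : Prop :=
  ∀ I : Ideal R, I.FG → idealHeight I M = (polynomialGrade I M : WithBot ℕ∞)

end CM

end NonNoethCM

end

/-!
Let `x₁, …, x_i` be a nonempty initial segment of the sequence. If `H^i` of its Čech complex does
not vanish at `p`, then `dim M_p ≥ i`: when `dim M_p < i`, iterating the boundary ideals
`(J : x^∞) + (x)` shows that, for each `m ∈ M` and locally at `p`, the product
`(x₁ ⋯ x_i)^k` acts on `m` as an element of the ideal `(x₁^(k+1), …, x_i^(k+1))`. Applied to powers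
of the `x_j`, this turns every top-degree Čech fraction into a boundary. Hence
`ht_M (x₁, …, x_i) ≥ i`, and by hypothesis the polynomial grade of `(x₁, …, x_i)` is at least `i`.

Now suppose that `x₁, …, x_{i-1}` is weakly regular on `M`, and write `I = (x₁, …, x_i)` and
`M' = M / (x₁, …, x_{i-1}) M`. After adjoining variables, which is faithfully flat, `I` contains a
weakly regular sequence of length `i`, so `Ext^j(R/I, M) = 0` for `j < i` by Rees' argument.
Dimension shifting along `x₁, …, x_{i-1}` then gives `Hom(R/I, M') = 0`. An element of `M'` killed
by `x_i` is killed by `I`, so it is zero: `x_i` is a non-zero-divisor on `M'`.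
-/

namespace NonNoethCM

universe u v

section Ext

open CategoryTheory Abelian RingTheory.Sequence

variable {R : Type u} [CommRing R] [Small.{v} R] (Q : ModuleCat.{v} R)

lemma subsingleton_ext_quotSMulTop {N : ModuleCat.{v} R} {r : R} (hr : IsSMulRegular N r) {i : ℕ}
    [Subsingleton (Ext Q N i)] [Subsingleton (Ext Q N (i + 1))] :
    Subsingleton (Ext Q (ModuleCat.of R (QuotSMulTop r N)) i) :=
  AddCommGrpCat.subsingleton_of_isZero <| ShortComplex.Exact.isZero_of_both_zeros
    (Ext.covariant_sequence_exact₃' Q hr.smulShortComplex_shortExact i (i + 1) rfl)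
    ((AddCommGrpCat.isZero_of_iff_subsingleton.mpr ‹Subsingleton (Ext Q N i)›).eq_zero_of_src _)
    ((AddCommGrpCat.isZero_of_iff_subsingleton.mpr
      ‹Subsingleton (Ext Q N (i + 1))›).eq_zero_of_tgt _)

variable {Q}

lemma subsingleton_ext_of_mem_annihilator {N : ModuleCat.{v} R} {r : R} (hr : IsSMulRegular N r)
    (hrQ : r ∈ Module.annihilator R Q) {i : ℕ}
    (h : ∀ j, j + 1 = i → Subsingleton (Ext Q (ModuleCat.of R (QuotSMulTop r N)) j)) :
    Subsingleton (Ext Q N i) := by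
  let g := AddCommGrpCat.ofHom ((Ext.mk₀ (N.smulShortComplex r).f).postcomp Q (add_zero i))
  have hmono : Mono g := by
    cases i with
    | zero =>
      have := hr.smulShortComplex_shortExact.mono_f
      exact Ext.mono_postcomp_mk₀_of_mono Q _
    | succ j =>
      exact (Ext.covariant_sequence_exact₁' Q hr.smulShortComplex_shortExact j (j + 1)
        rfl).mono_g ((AddCommGrpCat.isZero_of_iff_subsingleton.mpr (h j rfl)).eq_zero_of_src _)
  have hzero : g = 0 := Ext.postcomp_smul_id_eq_zero_of_mem_annihilator hrQ i
  exact AddCommGrpCat.subsingleton_of_isZero (Limits.IsZero.of_mono_eq_zero g hzero)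

lemma subsingleton_ext_of_isWeaklyRegular {N : ModuleCat.{v} R} {rs : List R}
    (hrs : IsWeaklyRegular N rs) (hrsQ : ∀ r ∈ rs, r ∈ Module.annihilator R Q) {i : ℕ}
    (hi : i < rs.length) : Subsingleton (Ext Q N i) := by
  induction rs generalizing N i with
  | nil => simp at hi
  | cons r rs ih =>
    obtain ⟨hr, hrs⟩ := (isWeaklyRegular_cons_iff N r rs).mp hrs
    obtain ⟨hrQ, hrsQ⟩ := List.forall_mem_cons.mp hrsQ
    refine subsingleton_ext_of_mem_annihilator hr hrQ fun j hj => ?_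
    exact ih (N := ModuleCat.of R (QuotSMulTop r N)) hrs hrsQ
      (by simp only [List.length_cons] at hi; omega)

lemma subsingleton_linearMap_of_isWeaklyRegular {N : ModuleCat.{v} R} {rs : List R}
    (hrs : IsWeaklyRegular N rs) (h : ∀ i ≤ rs.length, Subsingleton (Ext Q N i)) :
    Subsingleton (Q →ₗ[R] N ⧸ (Ideal.ofList rs • ⊤ : Submodule R N)) := by
  induction rs generalizing N with
  | nil =>
    have := h 0 le_rfl
    have : Subsingleton (Q →ₗ[R] N) :=
      (Ext.addEquiv₀.trans ModuleCat.homAddEquiv).symm.subsingleton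
    exact (LinearEquiv.congrRight (M := Q)
      (Submodule.quotEquivOfEqBot _ (by simp))).toEquiv.subsingleton
  | cons r rs ih =>
    obtain ⟨hr, hrs⟩ := (isWeaklyRegular_cons_iff N r rs).mp hrs
    have := ih (N := ModuleCat.of R (QuotSMulTop r N)) hrs fun i hi => by
      have := h i (Nat.le_succ_of_le hi)
      have := h (i + 1) (Nat.succ_le_succ hi)
      exact subsingleton_ext_quotSMulTop Q hr
    exact (LinearEquiv.congrRight (M := Q)
      (Submodule.quotOfListConsSMulTopEquivQuotSMulTopInner N r rs)).toEquiv.subsingleton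

end Ext

section Grade

open RingTheory.Sequence

variable {R : Type u} [CommRing R] {I : Ideal R}

lemma torsionBySet_eq_bot_of_subsingleton_linearMap {P : Type*} [AddCommGroup P] [Module R P]
    [Subsingleton (R ⧸ I →ₗ[R] P)] : Submodule.torsionBySet R P (I : Set R) = ⊥ := by
  refine (Submodule.eq_bot_iff _).mpr fun z hz => ?_
  let f : R ⧸ I →ₗ[R] P :=
    Submodule.liftQ I (LinearMap.toSpanSingleton R P z) fun a ha =>
      (Submodule.mem_torsionBySet_iff _ z).mp hz ⟨a, ha⟩
  calc z = f (Submodule.Quotient.mk 1) := (one_smul R z).symm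
    _ = 0 := by rw [Subsingleton.elim f 0, LinearMap.zero_apply]

variable {M : Type v} [AddCommGroup M] [Module R M] {xs : List R}

lemma torsionBySet_quotient_eq_bot_of_length_lt_length [Small.{v} R] {ys : List R}
    (hxs : IsWeaklyRegular M xs) (hys : IsWeaklyRegular M ys) (hysI : ∀ y ∈ ys, y ∈ I)
    (hlt : xs.length < ys.length) :
    Submodule.torsionBySet R (M ⧸ (Ideal.ofList xs • ⊤ : Submodule R M)) (I : Set R) = ⊥ := by
  let e := Shrink.linearEquiv.{v} R (R ⧸ I)
  have hann : Module.annihilator R (Shrink.{v} (R ⧸ I)) = I :=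
    e.annihilator_eq.trans Ideal.annihilator_quotient
  have := subsingleton_linearMap_of_isWeaklyRegular (Q := ModuleCat.of R (Shrink.{v} (R ⧸ I)))
    (N := ModuleCat.of R M) hxs fun i hi =>
      subsingleton_ext_of_isWeaklyRegular hys (fun y hy => hann.ge (hysI y hy)) (hi.trans_lt hlt)
  have : Subsingleton (R ⧸ I →ₗ[R] M ⧸ (Ideal.ofList xs • ⊤ : Submodule R M)) :=
    (LinearEquiv.congrLeft _ R e).symm.toEquiv.subsingleton
  exact torsionBySet_eq_bot_of_subsingleton_linearMap

lemma torsionBySet_quotient_eq_bot_of_length_lt_grade [Small.{v} R] (hxs : IsWeaklyRegular M xs)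
    (hlt : (xs.length : ℕ∞) < grade I M) :
    Submodule.torsionBySet R (M ⧸ (Ideal.ofList xs • ⊤ : Submodule R M)) (I : Set R) = ⊥ := by
  obtain ⟨ys, ⟨hysI, hys⟩, hlen⟩ : ∃ ys : List R,
      ((∀ y ∈ ys, y ∈ I) ∧ IsWeaklyRegular M ys) ∧ (xs.length : ℕ∞) < ys.length := by
    simpa only [grade, lt_iSup_iff, exists_prop] using hlt
  exact torsionBySet_quotient_eq_bot_of_length_lt_length hxs hys hysI (Nat.cast_lt.mp hlen)

lemma torsionBySet_quotient_eq_bot_of_length_lt_polynomialGrade (hxs : IsWeaklyRegular M xs)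
    (hlt : (xs.length : ℕ∞) < polynomialGrade I M) :
    Submodule.torsionBySet R (M ⧸ (Ideal.ofList xs • ⊤ : Submodule R M)) (I : Set R) = ⊥ := by
  cases subsingleton_or_nontrivial R
  · have := Module.subsingleton R (M ⧸ (Ideal.ofList xs • ⊤ : Submodule R M))
    exact Subsingleton.elim _ _
  rw [polynomialGrade_eq_iSup] at hlt
  obtain ⟨m, hm⟩ := lt_iSup_iff.mp hlt
  let S := MvPolynomial (Fin m) R
  have hxsS : IsWeaklyRegular (S ⊗[R] M) (xs.map (algebraMap R S)) :=
    hxs.of_flat_of_isBaseChange (TensorProduct.isBaseChange R M S)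
  have hbot := torsionBySet_quotient_eq_bot_of_length_lt_grade hxsS (by rwa [List.length_map])
  let e := (Submodule.quotEquivOfEq _ _ (by rw [Ideal.map_ofList])).trans
    (TensorProduct.tensorQuotMapSMulEquivTensorQuot M S (Ideal.ofList xs))
  refine (Submodule.eq_bot_iff _).mpr fun z hz => ?_
  have hann : I.map (algebraMap R S) ≤
      LinearMap.ker (LinearMap.toSpanSingleton S _ (e.symm (1 ⊗ₜ z))) :=
    Ideal.map_le_iff_le_comap.mpr fun a ha => by
      have haz : a • z = 0 := (Submodule.mem_torsionBySet_iff _ z).mp hz ⟨a, ha⟩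
      rw [Ideal.mem_comap, LinearMap.mem_ker, LinearMap.toSpanSingleton_apply, ← map_smul,
        algebraMap_smul, ← TensorProduct.tmul_smul, haz, TensorProduct.tmul_zero, map_zero]
  have hmem : e.symm (1 ⊗ₜ z) ∈ (⊥ : Submodule S _) :=
    hbot ▸ (Submodule.mem_torsionBySet_iff _ _).mpr fun a => hann a.2
  rwa [Submodule.mem_bot, LinearEquiv.map_eq_zero_iff,
    Module.FaithfullyFlat.one_tmul_eq_zero_iff] at hmem

lemma isWeaklyRegular_of_le_polynomialGrade
    (h : ∀ i ≤ xs.length, (i : ℕ∞) ≤ polynomialGrade (Ideal.ofList (xs.take i)) M) :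
    IsWeaklyRegular M xs := by
  induction xs using List.reverseRecOn with
  | nil => exact .nil R M
  | append_singleton xs x ih =>
    have hxs : IsWeaklyRegular M xs := ih fun i hi => by
      simpa [List.take_append_of_le_length hi] using h i (by simp; omega)
    have hlt : (xs.length : ℕ∞) < polynomialGrade (Ideal.ofList (xs ++ [x])) M := by
      have hle := h (xs ++ [x]).length le_rfl
      rw [List.take_length, List.length_append] at hle
      exact (Nat.cast_lt.mpr xs.length.lt_succ_self).trans_le hle
    have hbot := torsionBySet_quotient_eq_bot_of_length_lt_polynomialGrade hxs hlt
    rw [isWeaklyRegular_append_iff, isWeaklyRegular_singleton_iff,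
      isSMulRegular_iff_right_eq_zero_of_smul]
    refine ⟨hxs, fun z hz => (Submodule.eq_bot_iff _).mp hbot z ?_⟩
    have hxsz := (Module.isTorsionBySet_iff_subset_annihilator R _).mp
      (Module.isTorsionBySet_quotient_ideal_smul M (Ideal.ofList xs))
    have hle : Ideal.ofList (xs ++ [x]) ≤ LinearMap.ker (LinearMap.toSpanSingleton R _ z) := by
      rw [Ideal.ofList_append, Ideal.ofList_singleton]
      exact sup_le (fun a ha => Module.mem_annihilator.mp (hxsz ha) z)
        ((Ideal.span_singleton_le_iff_mem _).mpr hz)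
    exact (Submodule.mem_torsionBySet_iff _ z).mpr fun a => hle a.2

end Grade

section Dimension

variable {R : Type u} [CommRing R]

/-- The Krull boundary ideal of `x` relative to `J`: the ideal `(J : x^∞) + (x)`, where the
saturation `(J : x^∞)` is encoded as the contraction of the extension of `J` to `R_x`. Its zero
locus is the boundary of the closed set `V(J) ∩ V(x)` in `V(J)`. -/
def krullBoundary (J : Ideal R) (x : R) : Ideal R :=
  (J.map (algebraMap R (Localization.Away x))).comap (algebraMap R (Localization.Away x)) ⊔
    Ideal.span {x}

lemma mem_krullBoundary_iff {J : Ideal R} {x r : R} :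
    r ∈ krullBoundary J x ↔ ∃ (m : ℕ) (a : R), x ^ m * (r + a * x) ∈ J := by
  simp only [krullBoundary, Submodule.mem_sup, Ideal.mem_comap,
    IsLocalization.algebraMap_mem_map_algebraMap_iff (Submonoid.powers x),
    Submonoid.mem_powers_iff, Ideal.mem_span_singleton']
  constructor
  · rintro ⟨y, ⟨_, ⟨m, rfl⟩, hy⟩, _, ⟨a, rfl⟩, rfl⟩
    exact ⟨m, -a, by rwa [neg_mul, add_neg_cancel_right]⟩
  · rintro ⟨m, a, h⟩
    exact ⟨r + a * x, ⟨_, ⟨m, rfl⟩, h⟩, _, ⟨-a, rfl⟩, by ring⟩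

lemma exists_lt_of_krullBoundary_le {J : Ideal R} {x : R} {q : PrimeSpectrum R}
    (h : krullBoundary J x ≤ q.asIdeal) : ∃ q' < q, J ≤ q'.asIdeal := by
  have hdisj : Disjoint (J : Set R) (Submonoid.powers x ⊔ q.asIdeal.primeCompl : Submonoid R) := by
    refine Set.disjoint_left.mpr fun r hrJ hr => ?_
    obtain ⟨_, ⟨m, rfl⟩, s, hs, rfl⟩ := Submonoid.mem_sup.mp hr
    exact hs (h (mem_krullBoundary_iff.mpr ⟨m, 0, by simpa using hrJ⟩))
  obtain ⟨q', hq', hJ, hd⟩ := Ideal.exists_le_prime_disjoint _ _ hdisj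
  refine ⟨⟨q', hq'⟩, lt_of_le_not_ge (fun r hr => ?_) fun hle => ?_, hJ⟩
  · exact not_not.mp fun hrq => Set.disjoint_left.mp hd hr (Submonoid.mem_sup_right hrq)
  · have hx : x ∈ q.asIdeal := h (mem_krullBoundary_iff.mpr ⟨0, -1, by simp⟩)
    exact Set.disjoint_left.mp hd (hle hx)
      (Submonoid.mem_sup_left (Submonoid.mem_powers x))

variable {ι : Type*} (x : ι → R)

lemma prod_pow_mul_mem_span_image_pow {T : Finset ι} {k m : ℕ} {z : R}
    (hz : z ∈ Ideal.span ((fun i => x i ^ k) '' T)) :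
    (∏ i ∈ T, x i ^ m) * z ∈ Ideal.span ((fun i => x i ^ (k + m)) '' T) := by
  induction hz using Submodule.span_induction with
  | mem z hz =>
    obtain ⟨i, hi, rfl⟩ := hz
    have hdvd : x i ^ m * x i ^ k ∣ (∏ i ∈ T, x i ^ m) * x i ^ k :=
      mul_dvd_mul_right (Finset.dvd_prod_of_mem _ hi) _
    refine Ideal.mem_of_dvd _ hdvd ?_
    rw [← pow_add, add_comm m]
    exact Ideal.subset_span ⟨i, hi, rfl⟩
  | zero => simp
  | add z w _ _ hz hw => rw [mul_add]; exact add_mem hz hw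
  | smul a z _ hz => rw [smul_eq_mul, mul_left_comm]; exact Ideal.mul_mem_left _ a hz

lemma exists_mul_prod_pow_mem_insert_of_krullBoundary [DecidableEq ι] {J : Ideal R} {i : ι}
    {T : Finset ι} (hi : i ∉ T) {s : R} {k : ℕ}
    (h : s * ∏ j ∈ T, x j ^ k ∈
      krullBoundary J (x i) ⊔ Ideal.span ((fun j => x j ^ (k + 1)) '' T)) :
    ∃ l, s * ∏ j ∈ insert i T, x j ^ l ∈
      J ⊔ Ideal.span ((fun j => x j ^ (l + 1)) '' (insert i T : Finset ι)) := by
  obtain ⟨y, hy, z, hz, hyz⟩ := Submodule.mem_sup.mp h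
  obtain ⟨m, a, hm⟩ := mem_krullBoundary_iff.mp hy
  set P := ∏ j ∈ T, x j ^ m with hP
  refine ⟨k + m, ?_⟩
  have hprod : s * ∏ j ∈ insert i T, x j ^ (k + m) =
      x i ^ k * P * (x i ^ m * (y + a * x i)) +
        (-(a * P) * x i ^ (k + m + 1) + x i ^ (k + m) * (P * z)) := by
    simp only [Finset.prod_insert hi, pow_add, Finset.prod_mul_distrib, ← hP]
    linear_combination (-(x i ^ k * x i ^ m * P)) * hyz
  have hz' := prod_pow_mul_mem_span_image_pow x (m := m) hz
  rw [hprod, Finset.coe_insert, Set.image_insert_eq, Ideal.span_insert]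
  refine Submodule.add_mem_sup (Ideal.mul_mem_left _ _ hm) (Submodule.add_mem_sup
    (Ideal.mul_mem_left _ _ (Ideal.mem_span_singleton_self _)) (Ideal.mul_mem_left _ _ ?_))
  rwa [add_right_comm] at hz'

lemma exists_ltSeries_or_exists_mul_prod_pow_mem (p : PrimeSpectrum R) (T : Finset ι)
    (J : Ideal R) :
    (∃ l : LTSeries (PrimeSpectrum R), l.length = T.card ∧ J ≤ l.head.asIdeal ∧ l.last ≤ p) ∨
      ∃ s ∉ p.asIdeal, ∃ k : ℕ,
        s * ∏ i ∈ T, x i ^ k ∈ J ⊔ Ideal.span ((fun i => x i ^ (k + 1)) '' T) := by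
  classical
  induction T using Finset.induction generalizing J with
  | empty =>
    by_cases hJ : J ≤ p.asIdeal
    · exact .inl ⟨RelSeries.singleton _ p, rfl, hJ, le_rfl⟩
    · obtain ⟨s, hsJ, hs⟩ := SetLike.not_le_iff_exists.mp hJ
      exact .inr ⟨s, hs, 0, by simpa using hsJ⟩
  | insert i T hi ih =>
    obtain ⟨l, hl, hhead, hlast⟩ | ⟨s, hs, k, hk⟩ := ih (krullBoundary J (x i))
    · obtain ⟨q, hq, hJq⟩ := exists_lt_of_krullBoundary_le hhead
      exact .inl ⟨l.cons q hq, by simp [hl, hi], by simpa using hJq, by simpa using hlast⟩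
    · exact .inr ⟨s, hs, exists_mul_prod_pow_mem_insert_of_krullBoundary x hi hk⟩

variable {M : Type v} [AddCommGroup M] [Module R M]

lemma mem_support_localizedModule {p : Ideal R} [p.IsPrime]
    {q : PrimeSpectrum (Localization.AtPrime p)}
    (hq : q.comap (algebraMap R (Localization.AtPrime p)) ∈ Module.support R M) :
    q ∈ Module.support (Localization.AtPrime p) (LocalizedModule p.primeCompl M) := by
  obtain ⟨m, hm⟩ := Module.mem_support_iff'.mp hq
  refine Module.mem_support_iff'.mpr ⟨LocalizedModule.mk m 1, fun r hr h0 => ?_⟩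
  obtain ⟨a, s, rfl⟩ := IsLocalization.exists_mk'_eq p.primeCompl r
  rw [← Localization.mk_eq_mk', LocalizedModule.mk_smul_mk, ← LocalizedModule.zero_mk 1,
    LocalizedModule.mk_eq] at h0
  obtain ⟨t, ht⟩ := h0
  refine hm (t * a) (fun hta => ?_) (by simpa [mul_smul, Submonoid.smul_def] using ht)
  obtain ht | ha := (PrimeSpectrum.isPrime _).mem_or_mem hta
  · exact q.isPrime.ne_top (Ideal.eq_top_of_isUnit_mem _ ht (IsLocalization.map_units _ t))
  · exact hr (by rw [IsLocalization.mk'_eq_mul_mk'_one]; exact Ideal.mul_mem_right _ _ ha)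

lemma length_le_primeHeight {p : PrimeSpectrum R} (l : LTSeries (PrimeSpectrum R))
    (hhead : l.head ∈ Module.support R M) (hlast : l.last ≤ p) :
    (l.length : WithBot ℕ∞) ≤ primeHeight M p := by
  let e := IsLocalization.AtPrime.primeSpectrumOrderIso (Localization.AtPrime p.asIdeal) p.asIdeal
  have hle (i) : l i ≤ p := (LTSeries.monotone l (Fin.le_last i)).trans hlast
  have hcomap (i) :
      (e.symm ⟨l i, hle i⟩).comap (algebraMap R (Localization.AtPrime p.asIdeal)) = l i :=
    congrArg Subtype.val (e.apply_symm_apply ⟨l i, hle i⟩)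
  have hsupp (i) : e.symm ⟨l i, hle i⟩ ∈
      Module.support (Localization.AtPrime p.asIdeal) (LocalizedModule p.asIdeal.primeCompl M) :=
    mem_support_localizedModule <| (hcomap i).symm ▸
      Module.mem_support_mono (LTSeries.monotone l (Fin.zero_le i)) hhead
  let lp : LTSeries (Module.support (Localization.AtPrime p.asIdeal)
      (LocalizedModule p.asIdeal.primeCompl M)) :=
    LTSeries.mk l.length (fun i => ⟨e.symm ⟨l i, hle i⟩, hsupp i⟩)
      fun i j hij => e.symm.strictMono (LTSeries.strictMono l hij)
  exact Order.LTSeries.length_le_krullDim lp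

lemma exists_mul_prod_pow_smul_eq_sum_of_primeHeight_lt [Fintype ι] {p : PrimeSpectrum R}
    (h : primeHeight M p < Fintype.card ι) (m : M) :
    ∃ s ∉ p.asIdeal, ∃ (k : ℕ) (c : ι → R),
      (s * ∏ i, x i ^ k) • m = (∑ i, c i * x i ^ (k + 1)) • m := by
  obtain ⟨l, hl, hhead, hlast⟩ | ⟨s, hs, k, hk⟩ :=
    exists_ltSeries_or_exists_mul_prod_pow_mem x p Finset.univ (R ∙ m).annihilator
  · have hsupp : l.head ∈ Module.support R M :=
      Module.mem_support_iff_exists_annihilator.mpr ⟨m, hhead⟩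
    exact absurd (length_le_primeHeight l hsupp hlast) (not_le.mpr (by rwa [hl, Finset.card_univ]))
  · rw [Finset.coe_univ, Set.image_univ] at hk
    obtain ⟨y, hy, z, hz, hyz⟩ := Submodule.mem_sup.mp hk
    obtain ⟨c, rfl⟩ := Ideal.mem_span_range_iff_exists_fun.mp hz
    refine ⟨s, hs, k, c, ?_⟩
    rw [← hyz, add_smul, (Submodule.mem_annihilator_span_singleton m y).mp hy, zero_add]

end Dimension

section Cech

open CategoryTheory LocalizedModule

variable {R : Type u} [CommRing R] {M : Type v} [AddCommGroup M] [Module R M]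

lemma sgn_mul_self {n : ℕ} (j : Fin n) (T : Finset (Fin n)) : sgn R j T * sgn R j T = 1 := by
  rw [sgn, ← pow_add, ← two_mul, pow_mul, neg_one_sq, one_pow]

lemma pow_smul_mk_pow (a : R) (m : M) (k : ℕ) :
    a ^ k • mk m (Submonoid.pow a k) = mkLinearMap (Submonoid.powers a) M m := by
  rw [smul'_mk]
  exact mk_cancel (Submonoid.pow a k) m

lemma pow_smul_mk_pow_add (a : R) (m : M) (k d : ℕ) :
    a ^ d • mk m (Submonoid.pow a (k + d)) = mk m (Submonoid.pow a k) := by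
  have hpow : Submonoid.pow a (k + d) = Submonoid.pow a k * Submonoid.pow a d :=
    Subtype.ext (pow_add a k d)
  rw [smul'_mk, hpow]
  exact mk_cancel_common_right (Submonoid.pow a k) (Submonoid.pow a d) m

lemma awayMap_mk_pow {a b c : R} (h : a ∣ b) (hb : a * c = b) (m : M) (k : ℕ) :
    awayMap M h (mk m (Submonoid.pow a k)) = c ^ k • mk m (Submonoid.pow b k) := by
  apply ((Module.End.isUnit_iff _).mp (isUnit_of_dvd M h (Submonoid.pow a k))).injective
  change a ^ k • awayMap M h _ = a ^ k • c ^ k • mk m (Submonoid.pow b k)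
  rw [← map_smul, pow_smul_mk_pow, awayMap_mk, smul_smul, ← mul_pow, hb, pow_smul_mk_pow]

section TopDegree

variable {p : ℕ} (x : Fin (p + 1) → R)

lemma awayMap_mem_range_cechD_top (j : Fin (p + 1))
    (z : Away M (∏ i ∈ Finset.univ.erase j, x i)) :
    awayMap M (prod_erase_dvd x Finset.univ j) z ∈
      LinearMap.range (LinearMap.proj ⟨Finset.univ, Finset.card_fin _⟩ ∘ₗ cechD M x p) := by
  have hcard : (Finset.univ.erase j).card = p := by simp
  refine ⟨Pi.single (M := fun S : IdxSet (p + 1) p => Away M (∏ i ∈ S.1, x i))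
    ⟨Finset.univ.erase j, hcard⟩ (sgn R j (Finset.univ.erase j) • z), ?_⟩
  simp only [LinearMap.comp_apply, LinearMap.proj_apply, cechD, LinearMap.coe_mk, AddHom.coe_mk]
  rw [Finset.sum_eq_single j]
  · rw [dif_pos (Finset.mem_univ j), Pi.single_eq_same, map_smul, smul_smul, sgn_mul_self,
      one_smul]
  · intro i _ hij
    rw [dif_pos (Finset.mem_univ i), Pi.single_eq_of_ne, map_zero, smul_zero]
    exact fun h => hij <| Finset.erase_injOn _ (Finset.mem_univ i) (Finset.mem_univ j)
      (congrArg Subtype.val h)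
  · exact fun h => absurd (Finset.mem_univ j) h

lemma pow_smul_mk_pow_mem_range_cechD_top (j : Fin (p + 1)) (m : M) (k : ℕ) :
    x j ^ k • mk m (Submonoid.pow (∏ i, x i) k) ∈
      LinearMap.range (LinearMap.proj ⟨Finset.univ, Finset.card_fin _⟩ ∘ₗ cechD M x p) := by
  rw [← awayMap_mk_pow (prod_erase_dvd x Finset.univ j)
    (Finset.prod_erase_mul _ _ (Finset.mem_univ j))]
  exact awayMap_mem_range_cechD_top x j _

lemma exists_smul_mem_range_cechD_top {q : PrimeSpectrum R} (h : primeHeight M q < (p + 1 : ℕ))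
    (f : CechX M x (p + 1)) : ∃ s ∉ q.asIdeal, s • f ∈ LinearMap.range (cechD M x p) := by
  let T : IdxSet (p + 1) (p + 1) := ⟨Finset.univ, Finset.card_fin _⟩
  have hT : ∀ S, S = T := fun S => Subtype.ext ((Finset.card_eq_iff_eq_univ _).mp (by simp [S.2]))
  suffices ∃ s ∉ q.asIdeal, s • f T ∈ LinearMap.range (LinearMap.proj T ∘ₗ cechD M x p) by
    obtain ⟨s, hs, g, hg⟩ := this
    exact ⟨s, hs, g, funext fun S => hT S ▸ hg⟩
  obtain ⟨m, k, hf⟩ : ∃ m k, f T = mk m (Submonoid.pow (∏ i, x i) k) := by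
    induction f T using LocalizedModule.induction_on with
    | h m t => obtain ⟨_, k, rfl⟩ := t; exact ⟨m, k, rfl⟩
  obtain ⟨s, hs, l, c, hm⟩ := exists_mul_prod_pow_smul_eq_sum_of_primeHeight_lt
    (fun i => x i ^ k) (by simpa using h) m
  refine ⟨s, hs, ?_⟩
  have hsf : s • f T = ∑ i, c i • x i ^ (k + k * l) •
      mk m (Submonoid.pow (∏ i, x i) (k + k * l)) := by
    simp_rw [hf, ← pow_smul_mk_pow_add _ m k (k * l), smul_smul, ← Finset.sum_smul, smul'_mk]
    congr 1
    convert hm using 2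
    · rw [← Finset.prod_pow]; simp_rw [← pow_mul]
    · simp_rw [← pow_mul, mul_add, mul_one, add_comm]
  rw [hsf]
  exact Submodule.sum_smul_mem _ _ fun i _ => pow_smul_mk_pow_mem_range_cechD_top x i m _

end TopDegree

lemma subsingleton_localizedModule_homology {ι : Type*} {c : ComplexShape ι}
    (K : HomologicalComplex (ModuleCat.{v} R) c) (S : Submonoid R) (i j : ι)
    (h : ∀ f : K.X j, ∃ s ∈ S, s • f ∈ LinearMap.range (K.d i j).hom) :
    Subsingleton (LocalizedModule S (K.homology j)) := by
  refine LocalizedModule.subsingleton_iff.mpr fun z => ?_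
  obtain ⟨z, rfl⟩ := (ModuleCat.epi_iff_surjective (K.homologyπ j)).mp inferInstance z
  obtain ⟨s, hs, g, hg⟩ := h (K.iCycles j z)
  have hz : s • z = K.toCycles i j g := by
    apply (ModuleCat.mono_iff_injective (K.iCycles j)).mp inferInstance
    rw [map_smul, ← ConcreteCategory.comp_apply, HomologicalComplex.toCycles_i]
    exact hg.symm
  refine ⟨s, hs, ?_⟩
  rw [← map_smul, hz, ← ConcreteCategory.comp_apply, HomologicalComplex.toCycles_comp_homologyπ]
  rfl

lemma le_primeHeight_of_nontrivial_cechCohomology {q : PrimeSpectrum R} {n : ℕ} (hn : n ≠ 0)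
    {x : Fin n → R}
    (h : Nontrivial (LocalizedModule q.asIdeal.primeCompl (cechCohomology M x n))) :
    (n : WithBot ℕ∞) ≤ primeHeight M q := by
  obtain ⟨p, rfl⟩ := Nat.exists_eq_succ_of_ne_zero hn
  by_contra! hlt
  refine not_subsingleton_iff_nontrivial.mpr h
    (subsingleton_localizedModule_homology (cechComplex M x) _ p (p + 1) fun f => ?_)
  rw [cechComplex_d]
  exact exists_smul_mem_range_cechD_top x hlt f

end Cech

section StrongParameterSequence

variable {R : Type u} [CommRing R] {M : Type v} [AddCommGroup M] [Module R M] {xs : List R}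

lemma length_le_idealHeight_of_nontrivial_cechCohomology (hne : xs ≠ [])
    (h : ∀ p ∈ Module.support R M ∩ PrimeSpectrum.zeroLocus (Ideal.ofList xs),
      Nontrivial (LocalizedModule p.asIdeal.primeCompl (cechCohomology M xs.get xs.length))) :
    (xs.length : WithBot ℕ∞) ≤ idealHeight (Ideal.ofList xs) M :=
  le_iInf₂ fun p hp =>
    le_primeHeight_of_nontrivial_cechCohomology (List.length_pos_iff.mpr hne).ne' (h p hp)

lemma IsStrongParameterSeq.nontrivial_cechCohomology [Module.Finite R M]
    (h : IsStrongParameterSeq R M xs) {i : ℕ} (hi : 1 ≤ i) (hix : i ≤ xs.length)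
    {p : PrimeSpectrum R}
    (hp : p ∈ Module.support R M ∩ PrimeSpectrum.zeroLocus (Ideal.ofList (xs.take i))) :
    Nontrivial (LocalizedModule p.asIdeal.primeCompl
      (cechCohomology M (xs.take i).get (xs.take i).length)) := by
  rw [← Module.support_quotient] at hp
  obtain hnil | ⟨-, -, hcech⟩ := h i hi hix
  · have := congrArg List.length hnil
    simp only [List.length_take, List.length_nil] at this
    omega
  · exact hcech p hp

lemma IsStrongParameterSeq.isRegularSeq (h : IsStrongParameterSeq R M xs)
    (hxs : RingTheory.Sequence.IsWeaklyRegular M xs) : IsRegularSeq R M xs := by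
  obtain rfl | hne := eq_or_ne xs []
  · exact .inl rfl
  have hpar := h xs.length (List.length_pos_iff.mpr hne) le_rfl
  rw [List.take_length] at hpar
  exact .inr ⟨hxs, (hpar.resolve_left hne).2.1.symm⟩

end StrongParameterSequence

end NonNoethCM

theorem mainTheorem10_general {R : Type*} [CommRing R] {M : Type*} [AddCommGroup M] [Module R M]
    (hM : ∀ I : Ideal R, I.FG →
      NonNoethCM.idealHeight I M ≤ (NonNoethCM.polynomialGrade I M : WithBot ℕ∞))
    {xs : List R}
    (hxs : ∀ i : ℕ, 1 ≤ i → i ≤ xs.length →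
      ∀ p ∈ Module.support R M ∩ PrimeSpectrum.zeroLocus (Ideal.ofList (xs.take i)),
        Nontrivial (LocalizedModule p.asIdeal.primeCompl
          (NonNoethCM.cechCohomology M (xs.take i).get (xs.take i).length))) :
    RingTheory.Sequence.IsWeaklyRegular M xs := by
  refine NonNoethCM.isWeaklyRegular_of_le_polynomialGrade fun i hi => ?_
  obtain rfl | hpos := Nat.eq_zero_or_pos i
  · exact zero_le
  have hlen : (xs.take i).length = i := List.length_take_of_le hi
  have hne : xs.take i ≠ [] := List.ne_nil_of_length_pos (hpos.trans_eq hlen.symm)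
  have hheight : (i : WithBot ℕ∞) ≤ NonNoethCM.idealHeight (Ideal.ofList (xs.take i)) M := by
    simpa only [hlen] using
      NonNoethCM.length_le_idealHeight_of_nontrivial_cechCohomology hne (hxs i hpos hi)
  have hfg : (Ideal.ofList (xs.take i)).FG := Submodule.fg_def.mpr ⟨_, List.finite_toSet _, rfl⟩
  exact WithBot.coe_le_coe.mp (hheight.trans (hM _ hfg))

theorem mainTheorem10 {R : Type*} [CommRing R] {M : Type*} [AddCommGroup M] [Module R M]
    [Module.Finite R M]
    (h : NonNoethCM.IsCohenMacaulayIdeals R M ∨ NonNoethCM.IsCohenMacaulayFGIdeals R M) :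
    NonNoethCM.IsCohenMacaulay R M :=
  fun _ hxs => hxs.isRegularSeq <| mainTheorem10_general (fun I hI => (h.elim (· I) (· I hI)).le)
    fun _ hi hix _ => hxs.nontrivial_cechCohomology hi hix
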